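/- **Proposition 5 (irreducible representations $\pi_{e,n}$).** Let $h,w\in\mathbb C$ and put $[e]_h=\sinh(he)/h$ for $e\in\mathbb C$. At $h=0$ or $w=0$ the quotients $\sinh(hx)/h$, $(e^{wx}-1)/w$, $(1-e^{-wx})/w$ are read as their limit $x$. The algebra $\mathcal U_{h,w}(\mathcal H(4))$ has generators $N,E,A^+,A$, with $E$ central and $$[A,A^+]=\frac{\sinh(hE)}{h}\,e^{wA^+},\qquad [N,A^+]=\frac{e^{wA^+}-1}{w},\qquad [N,A]=-A .$$ A *representation* of it on a Hausdorff locally convex complex vector space $V$ consists of continuous linear operators $N,E,A^+,A$ on $V$ satisfying these relations, such that all formal power series in $A^+$ converge (unconditionally) at each vector of $V$ and so does the series $\sinh(hE)/h$. It is *irreducible* if $V\neq0$ and the only closed subspaces stable under the generators are $0$ and $V$. It is a *lowest weight* representation if some nonzero vector is killed by $A$ and is an eigenvector of both $N$ and $E$. Two representations are *equivalent* if some linear homeomorphism intertwines the generators. Fix a choice of square roots of complex numbers, with $z^{(k+1)/2}:=(z^{1/2})^{k+1}$. Let $\mathcal V$ be the space of all formal series $\sum_{r\ge0}c_r|r\rangle$,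 $c_r\in\mathbb C$, with the topology of coefficientwise convergence. The vectors $|r\rangle$ form a basis of $\mathcal V$ (in the sense of convergent series) and an orthonormal basis of the Hilbert space of square-summable series. Then: 1. For all $e,n\in\mathbb C$ with $[e]_h\ne0$ there is exactly one representation $\pi_{e,n}$ on $\mathcal V$ such that for all $r\ge 0$ $$A|r\rangle=[e]_h^{1/2}\sqrt r\,|r-1\rangle,\qquad A^+|r\rangle=\sum_{k=0}^\infty\frac{w^k}{k+1}\,[e]_h^{(k+1)/2}\sqrt{\frac{(r+k+1)!}{r!}}\;|r+k+1\rangle,$$ $$\frac{1-e^{-wA^+}}{w}|r\rangle=[e]_h^{1/2}\sqrt{r+1}\,|r+1\rangle,\qquad E|r\rangle=e|r\rangle,\qquad N|r\rangle=(r+n)|r\rangle .$$ It is an infinite-dimensional irreducible lowest weight representation. 2. If $\pi_{e,n}$ and $\pi_{e',n'}$ are equivalent, then $e=e'$ and $n=n'$. 3. Every infinite-dimensional irreducible lowest weight representation of $\mathcal U_{h,w}(\mathcal H(4))$ is equivalent to $\pi_{e,n}$ for some $e,n\in\mathbb C$ with $[e]_h\ne0$. -/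

import Mathlib

/-- Coefficients of the power series `exp (t T) = ∑ t ^ k T ^ k / k!`. -/
noncomputable def expCoeff (t : ℂ) (k : ℕ) : ℂ := t ^ k / (k.factorial : ℂ)

/-- Coefficients of the power series `(exp (t T) - 1) / t = ∑_{k ≥ 1} t ^ (k - 1) T ^ k / k!`;
for `t = 0` this is its limit `T`. -/
noncomputable def expQuotCoeff (t : ℂ) (k : ℕ) : ℂ :=
  if k = 0 then 0 else t ^ (k - 1) / (k.factorial : ℂ)

/-- Coefficients of the power series `sinh (h T) / h = ∑_{k odd} h ^ (k - 1) T ^ k / k!`;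
for `h = 0` this is its limit `T`. -/
noncomputable def sinhQuotCoeff (h : ℂ) (k : ℕ) : ℂ :=
  if Odd k then h ^ (k - 1) / (k.factorial : ℂ) else 0

/-- The number `sinh (h e) / h`, read as its limit `e` for `h = 0`. -/
noncomputable def sinhQuot (h e : ℂ) : ℂ := if h = 0 then e else Complex.sinh (h * e) / h

theorem mul_expQuotCoeff (t : ℂ) (k : ℕ) :
    t * expQuotCoeff t k = expCoeff t k - if k = 0 then 1 else 0 := by
  rcases k with _ | k
  · simp [expQuotCoeff, expCoeff]
  · simp [expQuotCoeff, expCoeff, pow_succ]; ring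

theorem two_mul_mul_sinhQuotCoeff (h : ℂ) (k : ℕ) :
    2 * (h * sinhQuotCoeff h k) = expCoeff h k - expCoeff (-h) k := by
  rcases Nat.even_or_odd k with hk | hk
  · simp [sinhQuotCoeff, expCoeff, Nat.not_odd_iff_even.2 hk, hk.neg_pow]
  · obtain ⟨m, rfl⟩ := hk
    have : Odd (2 * m + 1) := ⟨m, rfl⟩
    simp only [sinhQuotCoeff, expCoeff, this, if_true, this.neg_pow, Nat.add_sub_cancel, pow_succ]
    ring

section

variable {V : Type*} [AddCommGroup V] [Module ℂ V] [TopologicalSpace V]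

/-- The vector `∑ k, c k • T ^ k u`, the value at `u` of the power series with coefficients `c`
in the operator `T`. -/
noncomputable def opSeries (c : ℕ → ℂ) (T : V →L[ℂ] V) (u : V) : V :=
  ∑' k : ℕ, c k • (T ^ k) u

end

/-- A representation of `U_{h,w}(H(4))` on a (Hausdorff, locally convex) complex vector space `V`:
continuous operators `N`, `E`, `Ap` (for `A⁺`), `A` that satisfy the defining relations
`[A, A⁺] = (sinh (h E) / h) e ^ (w A⁺)`, `[N, A⁺] = (e ^ (w A⁺) - 1) / w`, `[N, A] = - A`, with `E`
central. The elements `e ^ (w A⁺)` etc. of the algebra are formal power series in the generator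
`A⁺`, so formal power series in `A⁺` act on `V`; the series `sinh (h E) / h` converges on `V`. -/
structure TwistedHeisenbergRep (h w : ℂ) (V : Type*) [AddCommGroup V] [Module ℂ V]
    [TopologicalSpace V] where
  N : V →L[ℂ] V
  E : V →L[ℂ] V
  Ap : V →L[ℂ] V
  A : V →L[ℂ] V
  summable_Ap : ∀ (c : ℕ → ℂ) (u : V), Summable fun k : ℕ => c k • (Ap ^ k) u
  summable_E : ∀ u : V, Summable fun k : ℕ => sinhQuotCoeff h k • (E ^ k) u
  comm_A_Ap : ∀ u : V,
    A (Ap u) - Ap (A u) = opSeries (sinhQuotCoeff h) E (opSeries (expCoeff w) Ap u)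
  comm_N_Ap : ∀ u : V, N (Ap u) - Ap (N u) = opSeries (expQuotCoeff w) Ap u
  comm_N_A : ∀ u : V, N (A u) - A (N u) = - A u
  comm_E_N : ∀ u : V, E (N u) = N (E u)
  comm_E_Ap : ∀ u : V, E (Ap u) = Ap (E u)
  comm_E_A : ∀ u : V, E (A u) = A (E u)

namespace TwistedHeisenbergRep

variable {h w : ℂ}
variable {V : Type*} [AddCommGroup V] [Module ℂ V] [TopologicalSpace V]
variable {V' : Type*} [AddCommGroup V'] [Module ℂ V'] [TopologicalSpace V']

/-- The action of `(1 - e ^ (- w A⁺)) / w` (its limit `A⁺` for `w = 0`). -/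
noncomputable def X (ρ : TwistedHeisenbergRep h w V) (u : V) : V :=
  opSeries (expQuotCoeff (-w)) ρ.Ap u

/-- A subspace stable under all generators. -/
def IsStable (ρ : TwistedHeisenbergRep h w V) (W : Submodule ℂ V) : Prop :=
  ∀ u ∈ W, ρ.N u ∈ W ∧ ρ.E u ∈ W ∧ ρ.Ap u ∈ W ∧ ρ.A u ∈ W

/-- Irreducibility: the space is nonzero and its only closed stable subspaces are the trivial
ones. -/
def IsIrreducible (ρ : TwistedHeisenbergRep h w V) : Prop :=
  Nontrivial V ∧
    ∀ W : Submodule ℂ V, IsClosed (W : Set V) → ρ.IsStable W → W = ⊥ ∨ W = ⊤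

/-- There is a lowest weight vector (vacuum): a common eigenvector of `N` and of the central
element `E` that is annihilated by `A`. -/
def HasLowestWeightVector (ρ : TwistedHeisenbergRep h w V) : Prop :=
  ∃ v : V, v ≠ 0 ∧ ρ.A v = 0 ∧ (∃ n : ℂ, ρ.N v = n • v) ∧ ∃ e : ℂ, ρ.E v = e • v

/-- Equivalence of representations: a linear homeomorphism that intertwines the generators. -/
def Equivalent (ρ : TwistedHeisenbergRep h w V) (ρ' : TwistedHeisenbergRep h w V') : Prop :=
  ∃ φ : V ≃L[ℂ] V', ∀ u : V, φ (ρ.N u) = ρ'.N (φ u) ∧ φ (ρ.E u) = ρ'.E (φ u) ∧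
    φ (ρ.Ap u) = ρ'.Ap (φ u) ∧ φ (ρ.A u) = ρ'.A (φ u)

/-- The explicit action on vectors `ket r = |r⟩` with parameters `e`, `n`; here `s` is the chosen
square root of `sinh (h e) / h`, and `ket (r - 1)` has coefficient `0` for `r = 0`. -/
def ActsBy (ρ : TwistedHeisenbergRep h w V) (ket : ℕ → V) (s e n : ℂ) : Prop :=
  (∀ r : ℕ, ρ.A (ket r) = (s * (Real.sqrt r : ℂ)) • ket (r - 1)) ∧
  (∀ r : ℕ, HasSum
    (fun k : ℕ => (w ^ k / ((k : ℂ) + 1) * s ^ (k + 1) *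
      (Real.sqrt (((r + k + 1).factorial : ℝ) / (r.factorial : ℝ)) : ℂ)) • ket (r + k + 1))
    (ρ.Ap (ket r))) ∧
  (∀ r : ℕ, ρ.X (ket r) = (s * (Real.sqrt ((r : ℝ) + 1) : ℂ)) • ket (r + 1)) ∧
  (∀ r : ℕ, ρ.E (ket r) = e • ket r) ∧
  (∀ r : ℕ, ρ.N (ket r) = ((r : ℂ) + n) • ket r)

end TwistedHeisenbergRep

/-- The space of formal series `∑ r, c r |r⟩`, as the space of coefficient sequences with the
topology of coefficientwise convergence. -/
abbrev FockSpace : Type := ℕ → ℂ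

/-- The basis vector `|r⟩`. -/
def fockKet (r : ℕ) : FockSpace := Pi.single r 1

open Filter Topology PowerSeries

section SequenceSpace

variable {V : Type*} [AddCommGroup V] [Module ℂ V] [TopologicalSpace V]

theorem hasSum_smul_fockKet (c : ℕ → ℂ) :
    HasSum (fun r : ℕ => c r • fockKet r) (c : FockSpace) := by
  refine Pi.hasSum.2 fun m => ?_
  have := hasSum_ite_eq m (c m)
  convert this using 2 with r
  by_cases h : r = m
  · subst h; simp [fockKet]
  · simp [fockKet, h, Ne.symm h]

theorem FockSpace.clm_ext [T2Space V] {f g : FockSpace →L[ℂ] V}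
    (hfg : ∀ r, f (fockKet r) = g (fockKet r)) : f = g := by
  ext c
  have h1 := (hasSum_smul_fockKet c).mapL f
  have h2 := (hasSum_smul_fockKet c).mapL g
  simp only [map_smul, hfg] at h1 h2
  exact h1.unique h2

theorem FockSpace.clm_apply_mem (f : FockSpace →L[ℂ] V) (W : Submodule ℂ V)
    (hW : IsClosed (W : Set V)) (hf : ∀ r, f (fockKet r) ∈ W) (c : FockSpace) : f c ∈ W := by
  have h1 := (hasSum_smul_fockKet c).mapL f
  refine hW.mem_of_tendsto h1 (Eventually.of_forall fun s => ?_)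
  refine W.sum_mem fun r _ => ?_
  rw [map_smul]
  exact W.smul_mem _ (hf r)

theorem exists_strongDual_apply_ne_zero [IsTopologicalAddGroup V] [ContinuousSMul ℂ V] [T2Space V]
    [PolynormableSpace ℂ V] {x : V} (hx : x ≠ 0) : ∃ l : V →L[ℂ] ℂ, l x ≠ 0 := by
  let f : (ℂ ∙ x) →ₗ[ℂ] ℂ := (LinearEquiv.toSpanNonzeroSingleton ℂ V x hx).symm
  obtain ⟨l, hl⟩ := StrongDual.exists_extension (𝕜 := ℂ) (ℂ ∙ x) (LinearMap.toContinuousLinearMap f)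
  refine ⟨l, ?_⟩
  have := hl ⟨x, Submodule.mem_span_singleton_self x⟩
  simp only at this
  rw [this]
  simp [f, LinearEquiv.coord_self]

theorem finite_ne_zero_of_summable_mul {y : ℕ → ℂ}
    (hy : ∀ c : ℕ → ℂ, Summable fun k => c k * y k) : {k | y k ≠ 0}.Finite := by
  have h := (hy fun k => (y k)⁻¹).tendsto_cofinite_zero
  have h1 : ∀ᶠ k in cofinite, (y k)⁻¹ * y k ≠ 1 :=
    h.eventually_ne zero_ne_one
  refine (h1 : Set.Finite _).subset fun k hk => ?_
  simpa using inv_mul_cancel₀ hk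

/-- An injective continuous linear map from the space of all sequences to a Hausdorff locally
convex space has a continuous left inverse. -/
theorem FockSpace.exists_leftInverse [IsTopologicalAddGroup V] [ContinuousSMul ℂ V] [T2Space V]
    [PolynormableSpace ℂ V] (f : FockSpace →L[ℂ] V) (hf : Function.Injective f) :
    ∃ g : V →L[ℂ] FockSpace, ∀ c, g (f c) = c := by
  let D : Submodule ℂ (ℕ →₀ ℂ) :=
    { carrier := {m | ∃ l : V →L[ℂ] ℂ, ∀ c, l (f c) = Finsupp.linearCombination ℂ c m}
      add_mem' := by
        rintro a b ⟨l, hl⟩ ⟨l', hl'⟩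
        exact ⟨l + l', fun c => by simp [hl, hl']⟩
      zero_mem' := ⟨0, fun c => by simp⟩
      smul_mem' := by
        rintro a b ⟨l, hl⟩
        exact ⟨a • l, fun c => by simp [hl]⟩ }
  have hD : ∀ l : V →L[ℂ] ℂ, ∃ m : ℕ →₀ ℂ, ∀ c, l (f c) = Finsupp.linearCombination ℂ c m := by
    intro l
    have hs : ∀ c : FockSpace, HasSum (fun k => c k * l (f (fockKet k))) (l (f c)) := fun c => by
      simpa using ((hasSum_smul_fockKet c).mapL f).mapL l
    have hfin := finite_ne_zero_of_summable_mul fun c => (hs c).summable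
    refine ⟨Finsupp.onFinset hfin.toFinset (fun k => l (f (fockKet k))) (by simp), fun c => ?_⟩
    refine (hs c).unique ?_
    rw [Finsupp.linearCombination_apply, Finsupp.onFinset_sum _ (by simp)]
    have := hasSum_sum_of_ne_finset_zero (L := .unconditional ℕ) (f := fun k => c k * l (f (fockKet k)))
      (s := hfin.toFinset) (by simp +contextual)
    convert this using 2 with k
    simp [mul_comm]
  have htop : D = ⊤ := by
    by_contra hne
    obtain ⟨φ, hφ, hφD⟩ := Submodule.exists_dual_map_eq_bot_of_lt_top (lt_top_iff_ne_top.2 hne)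
      inferInstance
    apply hφ
    have hφc : ∀ m, φ m = Finsupp.linearCombination ℂ (fun k => φ (Finsupp.single k 1)) m := by
      intro m
      have : φ = Finsupp.linearCombination ℂ (fun k => φ (Finsupp.single k 1)) := by
        ext k; simp
      exact DFunLike.congr_fun this m
    have hc : (fun k => φ (Finsupp.single k 1) : FockSpace) = 0 := by
      apply hf
      rw [map_zero]
      by_contra hx
      obtain ⟨l, hl⟩ := exists_strongDual_apply_ne_zero hx
      obtain ⟨m, hm⟩ := hD l
      apply hl
      rw [hm, ← hφc]
      have : φ m ∈ D.map φ := Submodule.mem_map_of_mem ⟨l, hm⟩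
      simpa [hφD] using this
    ext k
    simpa using congrFun hc k
  have hcoord : ∀ r : ℕ, ∃ l : V →L[ℂ] ℂ, ∀ c : FockSpace, l (f c) = c r := by
    intro r
    have : Finsupp.single r 1 ∈ D := htop ▸ Submodule.mem_top
    obtain ⟨l, hl⟩ := this
    exact ⟨l, fun c => by simpa using hl c⟩
  choose l hl using hcoord
  exact ⟨ContinuousLinearMap.pi l, fun c => funext fun r => by simp [hl]⟩

/-- The continuous linear map `c ↦ ∑ k, c k • y k`, when all these series converge. -/
noncomputable def sumCLM [IsTopologicalAddGroup V] [ContinuousSMul ℂ V] [T2Space V]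
    [PolynormableSpace ℂ V] (y : ℕ → V) (hy : ∀ c : ℕ → ℂ, Summable fun k => c k • y k) :
    FockSpace →L[ℂ] V :=
  letI := IsTopologicalAddGroup.rightUniformSpace V
  haveI : IsUniformAddGroup V := isUniformAddGroup_of_addCommGroup
  continuousLinearMapOfTendsto
    (fun n : ℕ => ∑ k ∈ Finset.range n,
      (ContinuousLinearMap.proj (φ := fun _ : ℕ => ℂ) k).smulRight (y k))
    (f := fun c => ∑' k, c k • y k) (l := atTop)
    (tendsto_pi_nhds.2 fun c => by
      simpa [sum_apply] using (hy c).hasSum.tendsto_sum_nat)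

theorem hasSum_sumCLM [IsTopologicalAddGroup V] [ContinuousSMul ℂ V] [T2Space V]
    [PolynormableSpace ℂ V] (y : ℕ → V) (hy : ∀ c : ℕ → ℂ, Summable fun k => c k • y k)
    (c : FockSpace) : HasSum (fun k => c k • y k) (sumCLM y hy c) :=
  (hy c).hasSum

theorem sumCLM_fockKet [IsTopologicalAddGroup V] [ContinuousSMul ℂ V] [T2Space V]
    [PolynormableSpace ℂ V] (y : ℕ → V) (hy : ∀ c : ℕ → ℂ, Summable fun k => c k • y k)
    (k : ℕ) : sumCLM y hy (fockKet k) = y k := by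
  refine (hasSum_sumCLM y hy (fockKet k)).unique ?_
  convert hasSum_ite_eq k (y k) using 2 with r
  by_cases h : r = k
  · subst h; simp [fockKet]
  · simp [fockKet, h]

theorem FockSpace.not_finiteDimensional : ¬ FiniteDimensional ℂ FockSpace := by
  intro h
  have h1 : LinearIndependent ℂ fockKet := by
    have := Pi.linearIndependent_single_one ℕ ℂ
    exact this
  have := h1.finite
  exact not_finite ℕ

theorem exists_hilbertBasis_fockKet :
    ∃ b : HilbertBasis ℕ ℂ (lp (fun _ : ℕ => ℂ) 2),
      ∀ r : ℕ, ((b r : lp (fun _ : ℕ => ℂ) 2) : ℕ → ℂ) = fockKet r := by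
  refine ⟨HilbertBasis.ofRepr (LinearIsometryEquiv.refl ℂ _), fun r => ?_⟩
  ext m
  rw [← HilbertBasis.repr_symm_single]
  change lp.single (E := fun _ : ℕ => ℂ) 2 r 1 m = (Pi.single r 1 : ℕ → ℂ) m
  rw [lp.coeFn_single]

end SequenceSpace

theorem hasSum_sinhQuotCoeff_mul_pow (h e : ℂ) :
    HasSum (fun k => sinhQuotCoeff h k * e ^ k) (sinhQuot h e) := by
  by_cases hh : h = 0
  · subst hh
    simp only [sinhQuot, if_true]
    convert hasSum_ite_eq 1 e using 2 with k
    by_cases hk : k = 1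
    · subst hk; simp [sinhQuotCoeff]
    · simp only [sinhQuotCoeff, hk, if_false]
      split_ifs with ho
      · have : k - 1 ≠ 0 := by have := ho.pos; omega
        simp [this]
      · simp
  · simp only [sinhQuot, hh, if_false]
    have h1 := (Complex.hasSum_sinh (h * e)).div_const h
    have hinj : Function.Injective fun n : ℕ => 2 * n + 1 := fun a b hab => by simpa using hab
    refine (hinj.hasSum_iff ?_).1 (h1.congr_fun ?_)
    · intro k hk
      have : ¬ Odd k := fun ⟨m, hm⟩ => hk ⟨m, hm.symm⟩
      simp [sinhQuotCoeff, this]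
    · intro n
      have : Odd (2 * n + 1) := ⟨n, rfl⟩
      simp only [Function.comp, sinhQuotCoeff, this, if_true, Nat.add_sub_cancel]
      rw [mul_pow]
      field_simp
      ring

namespace PowerSeries

/-- The composition `∑ k, c k * L ^ k`, for `L` without constant term. -/
noncomputable def compSeries (c : ℕ → ℂ) (L : ℂ⟦X⟧) : ℂ⟦X⟧ :=
  mk fun m => ∑ k ∈ Finset.range (m + 1), c k * coeff m (L ^ k)

variable {L : ℂ⟦X⟧}

theorem coeff_pow_mul_of_lt (hL : constantCoeff L = 0) (g : ℂ⟦X⟧) {m k : ℕ} (h : m < k) :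
    coeff m (L ^ k * g) = 0 := by
  have h1 : X ∣ L := X_dvd_iff.2 hL
  exact X_pow_dvd_iff.1 ((pow_dvd_pow_of_dvd h1 k).mul_right g) m h

theorem coeff_compSeries_mul (hL : constantCoeff L = 0) (c : ℕ → ℂ) (g : ℂ⟦X⟧) (m : ℕ) :
    coeff m (compSeries c L * g) = ∑ k ∈ Finset.range (m + 1), c k * coeff m (L ^ k * g) := by
  simp only [coeff_mul, Finset.mul_sum]
  rw [Finset.sum_comm]
  refine Finset.sum_congr rfl fun ij hij => ?_
  have hle : ij.1 ≤ m := by have := Finset.HasAntidiagonal.mem_antidiagonal.1 hij; omega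
  rw [compSeries, coeff_mk, Finset.sum_mul]
  refine (Finset.sum_subset (Finset.range_mono (by omega)) fun k _ hk => ?_).trans
    (Finset.sum_congr rfl fun k _ => by ring)
  have := coeff_pow_mul_of_lt hL 1 (m := ij.1) (k := k) (by simpa using hk)
  rw [mul_one] at this
  rw [this]; ring

theorem hasSum_coeff_compSeries_mul (hL : constantCoeff L = 0) (c : ℕ → ℂ) (g : ℂ⟦X⟧) (m : ℕ) :
    HasSum (fun k => c k * coeff m (L ^ k * g)) (coeff m (compSeries c L * g)) := by
  rw [coeff_compSeries_mul hL]
  refine hasSum_sum_of_ne_finset_zero fun k hk => ?_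
  rw [coeff_pow_mul_of_lt hL g (by simpa using hk), mul_zero]

theorem compSeries_X (c : ℕ → ℂ) : compSeries c X = mk c := by
  ext m
  simp only [compSeries, coeff_mk, coeff_X_pow]
  simp

theorem constantCoeff_compSeries (c : ℕ → ℂ) (L : ℂ⟦X⟧) :
    constantCoeff (compSeries c L) = c 0 := by
  rw [← coeff_zero_eq_constantCoeff_apply, compSeries, coeff_mk]
  simp

theorem derivative_compSeries (hL : constantCoeff L = 0) (c : ℕ → ℂ) :
    derivative ℂ (compSeries c L) =
      compSeries (fun k => ((k : ℂ) + 1) * c (k + 1)) L * derivative ℂ L := by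
  ext m
  rw [coeff_derivative, coeff_compSeries_mul hL, compSeries, coeff_mk, Finset.sum_range_succ',
    add_mul, Finset.sum_mul]
  have h0 : coeff (m + 1) (L ^ 0) = 0 := by simp [coeff_one]
  rw [h0, mul_zero, zero_mul, add_zero]
  refine Finset.sum_congr rfl fun k _ => ?_
  have h1 : coeff (m + 1) (L ^ (k + 1)) * ((m : ℂ) + 1) =
      ((k : ℂ) + 1) * coeff m (L ^ k * derivative ℂ L) := by
    rw [← coeff_derivative, derivative_pow, mul_assoc, ← map_natCast (C (R := ℂ)), coeff_C_mul]
    simp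
  rw [mul_assoc, h1]; ring

theorem derivative_compSeries_expCoeff (hL : constantCoeff L = 0) (w : ℂ) :
    derivative ℂ (compSeries (expCoeff w) L) =
      C w * compSeries (expCoeff w) L * derivative ℂ L := by
  rw [derivative_compSeries hL]
  congr 1
  ext m
  rw [coeff_C_mul]
  simp only [compSeries, coeff_mk, Finset.mul_sum]
  refine Finset.sum_congr rfl fun k _ => ?_
  have : ((k.factorial : ℕ) : ℂ) ≠ 0 := by exact_mod_cast k.factorial_ne_zero
  have : (k : ℂ) + 1 ≠ 0 := by exact_mod_cast k.succ_ne_zero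
  simp only [expCoeff, Nat.factorial_succ, Nat.cast_mul, Nat.cast_succ, pow_succ]
  field_simp

theorem derivative_compSeries_expQuotCoeff (hL : constantCoeff L = 0) (w : ℂ) :
    derivative ℂ (compSeries (expQuotCoeff w) L) =
      compSeries (expCoeff w) L * derivative ℂ L := by
  rw [derivative_compSeries hL]
  congr 2
  funext k
  have : ((k.factorial : ℕ) : ℂ) ≠ 0 := by exact_mod_cast k.factorial_ne_zero
  have : (k : ℂ) + 1 ≠ 0 := by exact_mod_cast k.succ_ne_zero
  simp only [expQuotCoeff, expCoeff, Nat.factorial_succ, Nat.cast_mul, Nat.cast_succ,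
    Nat.succ_ne_zero, if_false, Nat.add_sub_cancel]
  field_simp

/-- The power series `- log (1 - w X) / w = ∑ k, w ^ k / (k + 1) * X ^ (k + 1)`. -/
noncomputable def logQuot (w : ℂ) : ℂ⟦X⟧ := X * mk fun k => w ^ k / ((k : ℂ) + 1)

theorem constantCoeff_logQuot (w : ℂ) : constantCoeff (logQuot w) = 0 := by simp [logQuot]

theorem coeff_succ_logQuot (w : ℂ) (k : ℕ) :
    coeff (k + 1) (logQuot w) = w ^ k / ((k : ℂ) + 1) := by
  rw [logQuot, coeff_succ_X_mul, coeff_mk]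

theorem derivative_logQuot (w : ℂ) : derivative ℂ (logQuot w) = mk fun k => w ^ k := by
  ext k
  have : (k : ℂ) + 1 ≠ 0 := by exact_mod_cast k.succ_ne_zero
  rw [coeff_derivative, coeff_succ_logQuot, coeff_mk]
  field_simp

theorem one_sub_mul_derivative_logQuot (w : ℂ) :
    (1 - C w * X) * derivative ℂ (logQuot w) = 1 := by
  rw [derivative_logQuot]
  ext k
  rw [sub_mul, one_mul, mul_assoc, map_sub, coeff_C_mul, coeff_one]
  rcases k with _ | k
  · simp
  · rw [coeff_succ_X_mul]; simp [pow_succ']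

theorem compSeries_expCoeff_logQuot (w : ℂ) :
    compSeries (expCoeff w) (logQuot w) = derivative ℂ (logQuot w) := by
  have h1 := one_sub_mul_derivative_logQuot w
  have h2 := derivative_compSeries_expCoeff (constantCoeff_logQuot w) w
  have h3 : (1 - C w * X) * compSeries (expCoeff w) (logQuot w) = 1 := by
    refine derivative.ext ?_ ?_
    · rw [Derivation.leibniz, h2]
      simp only [smul_eq_mul, map_sub, Derivation.leibniz, derivative_C, derivative_X,
        derivative_one]
      linear_combination (C w * compSeries (expCoeff w) (logQuot w)) * h1
    · simp [constantCoeff_compSeries, expCoeff]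
  linear_combination (derivative ℂ (logQuot w)) * h3 -
    (compSeries (expCoeff w) (logQuot w)) * h1

theorem compSeries_expQuotCoeff_logQuot (w : ℂ) :
    compSeries (expQuotCoeff w) (logQuot w) = X * derivative ℂ (logQuot w) := by
  have h1 := one_sub_mul_derivative_logQuot w
  have h2 := derivative_compSeries_expCoeff (constantCoeff_logQuot w) w
  rw [compSeries_expCoeff_logQuot] at h2
  refine derivative.ext ?_ ?_
  · rw [derivative_compSeries_expQuotCoeff (constantCoeff_logQuot w), compSeries_expCoeff_logQuot,
      Derivation.leibniz, h2]
    simp only [smul_eq_mul, derivative_X]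
    linear_combination (derivative ℂ (logQuot w)) * h1
  · simp [constantCoeff_compSeries, expQuotCoeff]

theorem compSeries_expQuotCoeff_neg_logQuot (w : ℂ) :
    compSeries (expQuotCoeff (-w)) (logQuot w) = X := by
  have h2 := derivative_compSeries_expCoeff (constantCoeff_logQuot w) w
  rw [compSeries_expCoeff_logQuot] at h2
  have h3 := derivative_compSeries_expCoeff (constantCoeff_logQuot w) (-w)
  have h4 : compSeries (expCoeff (-w)) (logQuot w) * derivative ℂ (logQuot w) = 1 := by
    refine derivative.ext ?_ ?_
    · rw [Derivation.leibniz, h2, h3]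
      simp only [smul_eq_mul, map_neg, derivative_one]
      ring
    · rw [map_mul, derivative_logQuot]
      simp [constantCoeff_compSeries, expCoeff]
  refine derivative.ext ?_ ?_
  · rw [derivative_compSeries_expQuotCoeff (constantCoeff_logQuot w), h4, derivative_X]
  · simp [constantCoeff_compSeries, expQuotCoeff]

end PowerSeries

/-- The coefficient of `x ^ r` in the power series that represents `|r⟩`. -/
noncomputable def ketCoeff (s : ℂ) (r : ℕ) : ℂ := (s ^ r * (Real.sqrt (r.factorial : ℝ) : ℂ))⁻¹

theorem ketCoeff_ne_zero {s : ℂ} (hs : s ≠ 0) (r : ℕ) : ketCoeff s r ≠ 0 := by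
  have : Real.sqrt (r.factorial : ℝ) ≠ 0 :=
    (Real.sqrt_pos.2 (by exact_mod_cast r.factorial_pos)).ne'
  exact inv_ne_zero (mul_ne_zero (pow_ne_zero _ hs) (by exact_mod_cast this))

theorem ketCoeff_eq_mul {s : ℂ} (hs : s ≠ 0) (r k : ℕ) :
    ketCoeff s r = ketCoeff s (r + k) *
      (s ^ k * (Real.sqrt (((r + k).factorial : ℝ) / (r.factorial : ℝ)) : ℂ)) := by
  have h1 : (Real.sqrt (r.factorial : ℝ) : ℂ) ≠ 0 := by
    exact_mod_cast (Real.sqrt_pos.2 (by exact_mod_cast r.factorial_pos)).ne'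
  have h2 : (Real.sqrt ((r + k).factorial : ℝ) : ℂ) ≠ 0 := by
    exact_mod_cast (Real.sqrt_pos.2 (by exact_mod_cast (r + k).factorial_pos)).ne'
  rw [Real.sqrt_div (by positivity), ketCoeff, ketCoeff, pow_add]
  push_cast
  field_simp

theorem ketCoeff_eq_succ {s : ℂ} (hs : s ≠ 0) (r : ℕ) :
    ketCoeff s r = ketCoeff s (r + 1) * (s * (Real.sqrt ((r : ℝ) + 1) : ℂ)) := by
  have h := ketCoeff_eq_mul hs r 1
  have h1 : ((r + 1).factorial : ℝ) / (r.factorial : ℝ) = (r : ℝ) + 1 := by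
    have : (r.factorial : ℝ) ≠ 0 := by exact_mod_cast r.factorial_ne_zero
    rw [Nat.factorial_succ]; push_cast; field_simp
  rwa [h1, pow_one] at h

namespace FockSpace

/-- The formal series `∑ c r |r⟩` as a power series in the raising operator. -/
noncomputable def toSeries (s : ℂ) (c : FockSpace) : ℂ⟦X⟧ := mk fun r => ketCoeff s r * c r

theorem toSeries_injective {s : ℂ} (hs : s ≠ 0) : Function.Injective (toSeries s) := by
  intro a b hab
  funext r
  have := congrArg (coeff r) hab
  simpa [toSeries, ketCoeff_ne_zero hs] using this

theorem toSeries_add (s : ℂ) (a b : FockSpace) :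
    toSeries s (a + b) = toSeries s a + toSeries s b := by
  ext r; simp [toSeries, mul_add]

theorem toSeries_sub (s : ℂ) (a b : FockSpace) :
    toSeries s (a - b) = toSeries s a - toSeries s b := by
  ext r; simp [toSeries, mul_sub]

theorem toSeries_smul (s z : ℂ) (a : FockSpace) : toSeries s (z • a) = C z * toSeries s a := by
  ext r; simp only [toSeries, coeff_C_mul, coeff_mk, Pi.smul_apply, smul_eq_mul]; ring

/-- Multiplication by a power series. -/
noncomputable def mulCLM (s : ℂ) (L : ℂ⟦X⟧) : FockSpace →L[ℂ] FockSpace where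
  toFun c := fun m => (ketCoeff s m)⁻¹ * coeff m (L * toSeries s c)
  map_add' a b := by funext m; simp [toSeries_add, mul_add]
  map_smul' z a := by
    funext m
    rw [toSeries_smul, mul_left_comm L, coeff_C_mul]
    simp only [RingHom.id_apply, Pi.smul_apply, smul_eq_mul]; ring
  cont := by
    refine continuous_pi fun m => ?_
    simp only [coeff_mul, toSeries, coeff_mk]
    fun_prop

theorem toSeries_mulCLM {s : ℂ} (hs : s ≠ 0) (L : ℂ⟦X⟧) (c : FockSpace) :
    toSeries s (mulCLM s L c) = L * toSeries s c := by
  ext m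
  have := ketCoeff_ne_zero hs m
  simp [toSeries, mulCLM]
  field_simp

theorem toSeries_mulCLM_pow {s : ℂ} (hs : s ≠ 0) (L : ℂ⟦X⟧) (c : FockSpace) (k : ℕ) :
    toSeries s ((mulCLM s L ^ k) c) = L ^ k * toSeries s c := by
  induction k with
  | zero => simp
  | succ k ih =>
    rw [pow_succ', mul_apply_eq_comp, toSeries_mulCLM hs, ih, pow_succ', mul_assoc]

theorem hasSum_smul_mulCLM_pow {s : ℂ} (hs : s ≠ 0) {L : ℂ⟦X⟧} (hL : constantCoeff L = 0)
    (c : ℕ → ℂ) (u : FockSpace) :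
    HasSum (fun k => c k • (mulCLM s L ^ k) u) (mulCLM s (compSeries c L) u) := by
  refine Pi.hasSum.2 fun m => ?_
  have h := (hasSum_coeff_compSeries_mul hL c (toSeries s u) m).mul_left (ketCoeff s m)⁻¹
  refine h.congr_fun fun k => ?_
  have h1 := toSeries_mulCLM_pow hs L u k
  rw [← h1, toSeries, coeff_mk, Pi.smul_apply, smul_eq_mul]
  have := ketCoeff_ne_zero hs m
  field_simp

theorem opSeries_mulCLM {s : ℂ} (hs : s ≠ 0) {L : ℂ⟦X⟧} (hL : constantCoeff L = 0)
    (c : ℕ → ℂ) (u : FockSpace) :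
    opSeries c (mulCLM s L) u = mulCLM s (compSeries c L) u :=
  (hasSum_smul_mulCLM_pow hs hL c u).tsum_eq

/-- The lowering operator. -/
noncomputable def lowering (s : ℂ) : FockSpace →L[ℂ] FockSpace where
  toFun c := fun r => s * (Real.sqrt ((r : ℝ) + 1) : ℂ) * c (r + 1)
  map_add' a b := by funext m; simp [mul_add]
  map_smul' z a := by funext m; simp only [RingHom.id_apply, Pi.smul_apply, smul_eq_mul]; ring
  cont := by fun_prop

theorem lowering_apply (s : ℂ) (c : FockSpace) (r : ℕ) :
    lowering s c r = s * (Real.sqrt ((r : ℝ) + 1) : ℂ) * c (r + 1) := rfl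

theorem toSeries_lowering {s : ℂ} (hs : s ≠ 0) (c : FockSpace) :
    toSeries s (lowering s c) = C (s ^ 2) * derivative ℂ (toSeries s c) := by
  ext r
  rw [coeff_C_mul, coeff_derivative, toSeries, toSeries, coeff_mk, coeff_mk, lowering_apply,
    ketCoeff_eq_succ hs]
  have : (Real.sqrt ((r : ℝ) + 1) : ℂ) ^ 2 = r + 1 := by
    rw [← Complex.ofReal_pow, Real.sq_sqrt (by positivity)]; push_cast; rfl
  linear_combination ketCoeff s (r + 1) * s ^ 2 * c (r + 1) * this

/-- The number operator, shifted by `n`. -/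
noncomputable def number (n : ℂ) : FockSpace →L[ℂ] FockSpace where
  toFun c := fun r => ((r : ℂ) + n) * c r
  map_add' a b := by funext m; simp [mul_add]
  map_smul' z a := by funext m; simp only [RingHom.id_apply, Pi.smul_apply, smul_eq_mul]; ring
  cont := by fun_prop

theorem number_apply (n : ℂ) (c : FockSpace) (r : ℕ) : number n c r = ((r : ℂ) + n) * c r := rfl

theorem toSeries_number (s n : ℂ) (c : FockSpace) :
    toSeries s (number n c) = C n * toSeries s c + X * derivative ℂ (toSeries s c) := by
  ext r
  rw [map_add, coeff_C_mul]
  rcases r with _ | r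
  · simp [toSeries, number_apply]; ring
  · rw [coeff_succ_X_mul, coeff_derivative, toSeries, toSeries, coeff_mk, coeff_mk, number_apply]
    push_cast; ring

/-- Multiplication by a scalar. -/
noncomputable def scalar (e : ℂ) : FockSpace →L[ℂ] FockSpace := e • ContinuousLinearMap.id ℂ _

theorem scalar_apply (e : ℂ) (u : FockSpace) : scalar e u = e • u := rfl

end FockSpace

section EigenSeries

variable {V : Type*} [AddCommGroup V] [Module ℂ V] [TopologicalSpace V]

theorem ContinuousLinearMap.pow_apply_of_eigen {T : V →L[ℂ] V} {e : ℂ} {u : V} (hu : T u = e • u)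
    (k : ℕ) : (T ^ k) u = e ^ k • u := by
  induction k with
  | zero => simp
  | succ k ih => rw [pow_succ', mul_apply_eq_comp, ih, map_smul, hu, smul_smul, pow_succ]

theorem hasSum_sinhQuotCoeff_smul_pow [IsTopologicalAddGroup V] [ContinuousSMul ℂ V]
    {T : V →L[ℂ] V} {e : ℂ} {u : V} (hu : T u = e • u) (h : ℂ) :
    HasSum (fun k => sinhQuotCoeff h k • (T ^ k) u) (sinhQuot h e • u) := by
  refine ((hasSum_sinhQuotCoeff_mul_pow h e).smul_const u).congr_fun fun k => ?_
  rw [ContinuousLinearMap.pow_apply_of_eigen hu, smul_smul]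

theorem opSeries_sinhQuotCoeff [IsTopologicalAddGroup V] [ContinuousSMul ℂ V] [T2Space V]
    {T : V →L[ℂ] V} {e : ℂ} {u : V} (hu : T u = e • u) (h : ℂ) :
    opSeries (sinhQuotCoeff h) T u = sinhQuot h e • u :=
  (hasSum_sinhQuotCoeff_smul_pow hu h).tsum_eq

end EigenSeries

open FockSpace in
/-- The representation `π_{e,n}`; `s` is a square root of `sinh (h e) / h`. -/
noncomputable def fockRep (h w : ℂ) {s e : ℂ} (n : ℂ) (hs : s ≠ 0) (hse : s ^ 2 = sinhQuot h e) :
    TwistedHeisenbergRep h w FockSpace where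
  N := number n
  E := scalar e
  Ap := mulCLM s (logQuot w)
  A := lowering s
  summable_Ap c u := (hasSum_smul_mulCLM_pow hs (constantCoeff_logQuot w) c u).summable
  summable_E u := (hasSum_sinhQuotCoeff_smul_pow (scalar_apply e u) h).summable
  comm_A_Ap u := by
    rw [opSeries_mulCLM hs (constantCoeff_logQuot w), opSeries_sinhQuotCoeff (scalar_apply e _)]
    apply toSeries_injective hs
    rw [toSeries_sub, toSeries_lowering hs, toSeries_mulCLM hs, toSeries_mulCLM hs,
      toSeries_lowering hs, toSeries_smul, toSeries_mulCLM hs, compSeries_expCoeff_logQuot, ← hse,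
      Derivation.leibniz]
    simp only [smul_eq_mul]
    ring
  comm_N_Ap u := by
    rw [opSeries_mulCLM hs (constantCoeff_logQuot w)]
    apply toSeries_injective hs
    rw [toSeries_sub, toSeries_number, toSeries_mulCLM hs, toSeries_mulCLM hs,
      toSeries_number, toSeries_mulCLM hs, compSeries_expQuotCoeff_logQuot, Derivation.leibniz]
    simp only [smul_eq_mul]
    ring
  comm_N_A u := by
    funext r
    simp only [Pi.sub_apply, Pi.neg_apply, number_apply, lowering_apply]
    push_cast; ring
  comm_E_N u := by simp [scalar_apply]
  comm_E_Ap u := by simp [scalar_apply]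
  comm_E_A u := by simp [scalar_apply]

theorem FockSpace.fockKet_apply (r m : ℕ) : fockKet r m = if m = r then 1 else 0 := by
  rw [fockKet, Pi.single_apply]

namespace FockSpace

theorem toSeries_fockKet (s : ℂ) (r : ℕ) : toSeries s (fockKet r) = C (ketCoeff s r) * X ^ r := by
  ext m
  rw [toSeries, coeff_mk, coeff_C_mul, coeff_X_pow, fockKet_apply]
  split_ifs with hm
  · rw [hm]
  · simp

theorem mulCLM_fockKet_add (s : ℂ) (L : ℂ⟦X⟧) (r k : ℕ) :
    mulCLM s L (fockKet r) (k + r) = (ketCoeff s (k + r))⁻¹ * (ketCoeff s r * coeff k L) := by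
  change (ketCoeff s (k + r))⁻¹ * coeff (k + r) (L * toSeries s (fockKet r)) = _
  rw [toSeries_fockKet, mul_left_comm, coeff_C_mul, coeff_mul_X_pow]

theorem mulCLM_fockKet_of_lt (s : ℂ) (L : ℂ⟦X⟧) {r m : ℕ} (h : m < r) :
    mulCLM s L (fockKet r) m = 0 := by
  change (ketCoeff s m)⁻¹ * coeff m (L * toSeries s (fockKet r)) = _
  rw [toSeries_fockKet, mul_left_comm, coeff_C_mul, coeff_mul_X_pow', if_neg (not_le.2 h)]
  simp

theorem lowering_fockKet (s : ℂ) (r : ℕ) :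
    lowering s (fockKet r) = (s * (Real.sqrt r : ℂ)) • fockKet (r - 1) := by
  funext m
  rw [lowering_apply, Pi.smul_apply, fockKet_apply, fockKet_apply, smul_eq_mul]
  rcases r with _ | r
  · simp
  · by_cases hm : m = r
    · simp [hm]
    · simp [hm]

theorem number_fockKet (n : ℂ) (r : ℕ) : number n (fockKet r) = ((r : ℂ) + n) • fockKet r := by
  funext m
  rw [number_apply, Pi.smul_apply, fockKet_apply, smul_eq_mul]
  split_ifs with hm
  · rw [hm]
  · simp

theorem mulCLM_X_fockKet {s : ℂ} (hs : s ≠ 0) (r : ℕ) :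
    mulCLM s X (fockKet r) = (s * (Real.sqrt ((r : ℝ) + 1) : ℂ)) • fockKet (r + 1) := by
  apply toSeries_injective hs
  rw [toSeries_mulCLM hs, toSeries_smul, toSeries_fockKet, toSeries_fockKet, ketCoeff_eq_succ hs]
  simp only [map_mul, pow_succ]
  ring

theorem hasSum_mulCLM_logQuot_fockKet {s : ℂ} (hs : s ≠ 0) (w : ℂ) (r : ℕ) :
    HasSum (fun k : ℕ => (w ^ k / ((k : ℂ) + 1) * s ^ (k + 1) *
      (Real.sqrt (((r + k + 1).factorial : ℝ) / (r.factorial : ℝ)) : ℂ)) • fockKet (r + k + 1))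
      (mulCLM s (logQuot w) (fockKet r)) := by
  have hinj : Function.Injective fun k : ℕ => r + k + 1 := fun a b hab => by simpa using hab
  refine (((hinj.hasSum_iff ?_).2
    (hasSum_smul_fockKet (mulCLM s (logQuot w) (fockKet r))))).congr_fun ?_
  · intro m hm
    rcases lt_trichotomy m r with h | h | h
    · rw [mulCLM_fockKet_of_lt s _ h, zero_smul]
    · have := mulCLM_fockKet_add s (logQuot w) r 0
      rw [zero_add] at this
      rw [h, this]
      simp [constantCoeff_logQuot]
    · exact absurd ⟨m - r - 1, by simp only; omega⟩ hm
  · intro k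
    have h1 := mulCLM_fockKet_add s (logQuot w) r (k + 1)
    have h2 := ketCoeff_eq_mul hs r (k + 1)
    have h3 := ketCoeff_ne_zero hs (r + (k + 1))
    simp only [Function.comp]
    rw [show r + k + 1 = k + 1 + r by ring, h1, coeff_succ_logQuot, h2,
      show k + 1 + r = r + (k + 1) by ring]
    congr 1
    field_simp

end FockSpace

namespace TwistedHeisenbergRep

open FockSpace

section

variable {h w : ℂ} {V : Type*} [AddCommGroup V] [Module ℂ V] [TopologicalSpace V]

theorem fockRep_actsBy {s e : ℂ} (n : ℂ) (hs : s ≠ 0) (hse : s ^ 2 = sinhQuot h e) :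
    (fockRep h w n hs hse).ActsBy fockKet s e n := by
  refine ⟨lowering_fockKet s, hasSum_mulCLM_logQuot_fockKet hs w, fun r => ?_, fun r => rfl,
    number_fockKet n⟩
  rw [X, fockRep, opSeries_mulCLM hs (constantCoeff_logQuot w),
    compSeries_expQuotCoeff_neg_logQuot, mulCLM_X_fockKet hs]

theorem ActsBy.eq {ρ ρ' : TwistedHeisenbergRep h w FockSpace} {s e n : ℂ}
    (hρ : ρ.ActsBy fockKet s e n) (hρ' : ρ'.ActsBy fockKet s e n) : ρ = ρ' := by
  have hN : ρ.N = ρ'.N := clm_ext fun r => by rw [hρ.2.2.2.2, hρ'.2.2.2.2]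
  have hE : ρ.E = ρ'.E := clm_ext fun r => by rw [hρ.2.2.2.1, hρ'.2.2.2.1]
  have hAp : ρ.Ap = ρ'.Ap := clm_ext fun r => (hρ.2.1 r).unique (hρ'.2.1 r)
  have hA : ρ.A = ρ'.A := clm_ext fun r => by rw [hρ.1, hρ'.1]
  cases ρ
  cases ρ'
  simp only at hN hE hAp hA
  subst hN hE hAp hA
  rfl

theorem IsStable.opSeries_mem {ρ : TwistedHeisenbergRep h w V} {W : Submodule ℂ V}
    (hW : ρ.IsStable W) (hc : IsClosed (W : Set V)) (c : ℕ → ℂ) {u : V} (hu : u ∈ W) :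
    opSeries c ρ.Ap u ∈ W := by
  have hpow : ∀ k, (ρ.Ap ^ k) u ∈ W := by
    intro k
    induction k with
    | zero => simpa using hu
    | succ k ih =>
      rw [pow_succ', mul_apply_eq_comp]
      exact (hW _ ih).2.2.1
  exact hc.mem_of_tendsto (ρ.summable_Ap c u).hasSum
    (Eventually.of_forall fun t => W.sum_mem fun k _ => W.smul_mem _ (hpow k))

/-- A closed subspace stable under the number operator contains the basis vectors that occur in its
elements. -/
theorem fockKet_mem_of_number_mem {W : Submodule ℂ FockSpace} (hc : IsClosed (W : Set FockSpace))
    {n : ℂ} (hW : ∀ u ∈ W, number n u ∈ W) {u : FockSpace} (hu : u ∈ W) {r : ℕ} (hr : u r ≠ 0) :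
    fockKet r ∈ W := by
  let p : ℕ → FockSpace := fun M j =>
    (∏ i ∈ (Finset.range M).erase r, ((j : ℂ) - i) / ((r : ℂ) - i)) * u j
  have hp : ∀ M, p M ∈ W := by
    intro M
    have : ∀ S : Finset ℕ, (fun j : ℕ => (∏ i ∈ S, ((j : ℂ) - i) / ((r : ℂ) - i)) * u j : FockSpace) ∈ W := by
      intro S
      induction S using Finset.induction_on with
      | empty => simpa using hu
      | insert a S ha ih =>
        have h1 := W.smul_mem ((r : ℂ) - a)⁻¹ (W.sub_mem (hW _ ih) (W.smul_mem (n + a) ih))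
        convert h1 using 1
        funext j
        rw [Finset.prod_insert ha]
        simp only [Pi.smul_apply, Pi.sub_apply, number_apply, smul_eq_mul]
        ring
    exact this _
  have hlim : Tendsto p atTop (𝓝 (u r • fockKet r)) := by
    refine tendsto_pi_nhds.2 fun j => ?_
    refine tendsto_const_nhds.congr' ?_
    filter_upwards [eventually_gt_atTop j] with M hM
    simp only [Pi.smul_apply, fockKet_apply, smul_eq_mul, p]
    by_cases hj : j = r
    · subst hj
      rw [Finset.prod_congr rfl (g := fun _ => (1 : ℂ))]
      · simp
      · intro i hi
        refine div_self (sub_ne_zero.2 ?_)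
        exact_mod_cast (Finset.ne_of_mem_erase hi).symm
    · rw [if_neg hj, Finset.prod_eq_zero (i := j)]
      · simp
      · simp [hj, hM]
      · simp
  have := hc.mem_of_tendsto hlim (Eventually.of_forall hp)
  have h2 := W.smul_mem (u r)⁻¹ this
  rwa [smul_smul, inv_mul_cancel₀ hr, one_smul] at h2

theorem fockRep_isIrreducible {s e : ℂ} (n : ℂ) (hs : s ≠ 0) (hse : s ^ 2 = sinhQuot h e) :
    (fockRep h w n hs hse).IsIrreducible := by
  have hact := fockRep_actsBy (w := w) n hs hse
  refine ⟨inferInstance, fun W hc hW => or_iff_not_imp_left.2 fun hbot => ?_⟩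
  have hsqrt : ∀ r : ℕ, (s * (Real.sqrt ((r : ℝ) + 1) : ℂ)) ≠ 0 := fun r => by
    have : Real.sqrt ((r : ℝ) + 1) ≠ 0 := (Real.sqrt_pos.2 (by positivity)).ne'
    exact mul_ne_zero hs (by exact_mod_cast this)
  obtain ⟨u, hu, hu0⟩ := Submodule.exists_mem_ne_zero_of_ne_bot hbot
  obtain ⟨r, hr⟩ := Function.ne_iff.1 hu0
  have hket : fockKet r ∈ W := fockKet_mem_of_number_mem hc (fun u hu => (hW u hu).1) hu hr
  have hdown : ∀ r, fockKet (r + 1) ∈ W → fockKet r ∈ W := by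
    intro r hr
    have h1 := (hW _ hr).2.2.2
    rw [hact.1] at h1
    refine (W.smul_mem_iff ?_).1 h1
    have := hsqrt r
    push_cast at this ⊢
    exact this
  have hup : ∀ r, fockKet r ∈ W → fockKet (r + 1) ∈ W := by
    intro r hr
    have h1 : (fockRep h w n hs hse).X (fockKet r) ∈ W := hW.opSeries_mem hc _ hr
    rw [hact.2.2.1] at h1
    exact (W.smul_mem_iff (hsqrt r)).1 h1
  have h0 : fockKet 0 ∈ W := by
    clear hr
    induction r with
    | zero => exact hket
    | succ r ih => exact ih (hdown r hket)
  have hall : ∀ r, fockKet r ∈ W := fun r => by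
    induction r with
    | zero => exact h0
    | succ r ih => exact hup r ih
  exact (Submodule.eq_top_iff').2 fun c =>
    clm_apply_mem (ContinuousLinearMap.id ℂ FockSpace) W hc hall c

theorem fockKet_ne_zero (r : ℕ) : fockKet r ≠ 0 := fun h => by
  simpa [fockKet_apply] using congrFun h r

theorem fockRep_fockKet_zero {s e : ℂ} (n : ℂ) (hs : s ≠ 0) (hse : s ^ 2 = sinhQuot h e) :
    (fockRep h w n hs hse).A (fockKet 0) = 0 ∧
      (fockRep h w n hs hse).N (fockKet 0) = n • fockKet 0 ∧
      (fockRep h w n hs hse).E (fockKet 0) = e • fockKet 0 := by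
  have hact := fockRep_actsBy (w := w) n hs hse
  refine ⟨?_, ?_, hact.2.2.2.1 0⟩
  · rw [hact.1]; simp
  · rw [hact.2.2.2.2]; simp

theorem fockRep_hasLowestWeightVector {s e : ℂ} (n : ℂ) (hs : s ≠ 0)
    (hse : s ^ 2 = sinhQuot h e) : (fockRep h w n hs hse).HasLowestWeightVector := by
  obtain ⟨hA, hN, hE⟩ := fockRep_fockKet_zero (w := w) n hs hse
  exact ⟨fockKet 0, fockKet_ne_zero 0, hA, ⟨n, hN⟩, e, hE⟩

theorem eq_smul_fockKet_of_lowering_eq_zero {s : ℂ} (hs : s ≠ 0) {u : FockSpace}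
    (hu : lowering s u = 0) : u = u 0 • fockKet 0 := by
  funext r
  rw [Pi.smul_apply, fockKet_apply]
  rcases r with _ | r
  · simp
  · have h1 := congrFun hu r
    rw [lowering_apply, Pi.zero_apply] at h1
    have h2 : Real.sqrt ((r : ℝ) + 1) ≠ 0 := (Real.sqrt_pos.2 (by positivity)).ne'
    have h3 : (Real.sqrt ((r : ℝ) + 1) : ℂ) ≠ 0 := by exact_mod_cast h2
    have : u (r + 1) = 0 := by simpa [hs, h3] using h1
    simp [this]

theorem eq_of_equivalent_fockRep {s e n s' e' n' : ℂ} (hs : s ≠ 0) (hse : s ^ 2 = sinhQuot h e)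
    (hs' : s' ≠ 0) (hse' : s' ^ 2 = sinhQuot h e')
    (heq : (fockRep h w n hs hse).Equivalent (fockRep h w n' hs' hse')) : e = e' ∧ n = n' := by
  obtain ⟨φ, hφ⟩ := heq
  have hact := fockRep_actsBy (w := w) n hs hse
  obtain ⟨hN, hE, -, hA⟩ := hφ (fockKet 0)
  have hne : φ (fockKet 0) ≠ 0 := by simpa using fockKet_ne_zero 0
  constructor
  · rw [hact.2.2.2.1, map_smul] at hE
    exact smul_left_injective ℂ hne hE
  · rw [hact.1] at hA
    simp only [Nat.cast_zero, Real.sqrt_zero, Complex.ofReal_zero, mul_zero, zero_smul,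
      map_zero] at hA
    have h1 : φ (fockKet 0) = _ := eq_smul_fockKet_of_lowering_eq_zero hs' hA.symm
    have h2 : (fockRep h w n' hs' hse').N (φ (fockKet 0)) = n' • φ (fockKet 0) := by
      rw [h1, map_smul, (fockRep_actsBy (w := w) n' hs' hse').2.2.2.2, smul_comm]
      simp
    rw [hact.2.2.2.2, map_smul, h2] at hN
    simpa using smul_left_injective ℂ hne hN

end

end TwistedHeisenbergRep

namespace TwistedHeisenbergRep

open FockSpace

section

variable {h w : ℂ} {V : Type*} [AddCommGroup V] [Module ℂ V] [TopologicalSpace V]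
  {ρ : TwistedHeisenbergRep h w V} {v : V} {e : ℂ}

theorem E_pow_apply (hE : ρ.E v = e • v) (k : ℕ) : ρ.E ((ρ.Ap ^ k) v) = e • (ρ.Ap ^ k) v := by
  induction k with
  | zero => simpa using hE
  | succ k ih => rw [pow_succ', mul_apply_eq_comp, ρ.comm_E_Ap, ih, map_smul]

end

section Orbit

variable {h w : ℂ} {V : Type*} [AddCommGroup V] [Module ℂ V] [TopologicalSpace V]
  [IsTopologicalAddGroup V] [ContinuousSMul ℂ V] [T2Space V] [PolynormableSpace ℂ V]
  (ρ : TwistedHeisenbergRep h w V)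

/-- The map `f ↦ f(A⁺) v` on power series, given by their coefficients. -/
noncomputable def orbitMap (v : V) : FockSpace →L[ℂ] V :=
  sumCLM (fun k => (ρ.Ap ^ k) v) fun c => ρ.summable_Ap c v

theorem hasSum_orbitMap (v : V) (c : FockSpace) :
    HasSum (fun k => c k • (ρ.Ap ^ k) v) (ρ.orbitMap v c) := hasSum_sumCLM _ _ c

theorem orbitMap_fockKet (v : V) (k : ℕ) : ρ.orbitMap v (fockKet k) = (ρ.Ap ^ k) v :=
  sumCLM_fockKet _ _ k

/-- The vector `f(A⁺) v`. -/
noncomputable def orbit (v : V) (f : ℂ⟦X⟧) : V := ρ.orbitMap v fun k => coeff k f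

theorem orbit_add (v : V) (f g : ℂ⟦X⟧) : ρ.orbit v (f + g) = ρ.orbit v f + ρ.orbit v g := by
  rw [orbit, orbit, orbit, ← map_add]
  rfl

theorem orbit_zero (v : V) : ρ.orbit v 0 = 0 := map_zero (ρ.orbitMap v)

theorem orbit_C_mul (v : V) (z : ℂ) (f : ℂ⟦X⟧) : ρ.orbit v (C z * f) = z • ρ.orbit v f := by
  rw [orbit, orbit, ← map_smul]
  congr 1
  funext k
  simp

theorem orbit_X_pow (v : V) (k : ℕ) : ρ.orbit v (PowerSeries.X ^ k) = (ρ.Ap ^ k) v := by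
  rw [orbit, ← orbitMap_fockKet]
  congr 1
  funext m
  rw [coeff_X_pow, fockKet_apply]

theorem orbit_X_mul (v : V) (f : ℂ⟦X⟧) : ρ.orbit v (PowerSeries.X * f) = ρ.Ap (ρ.orbit v f) := by
  have h1 := (ρ.hasSum_orbitMap v fun k => coeff k f).mapL ρ.Ap
  have h2 := (hasSum_nat_add_iff' 1).2 (ρ.hasSum_orbitMap v fun k => coeff k (PowerSeries.X * f))
  simp only [coeff_succ_X_mul, Finset.range_one, Finset.sum_singleton, coeff_zero_X_mul, zero_smul,
    sub_zero] at h2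
  refine h2.unique (h1.congr_fun fun k => ?_)
  rw [map_smul, pow_succ', mul_apply_eq_comp]

theorem orbit_X_pow_mul (v : V) (k : ℕ) (f : ℂ⟦X⟧) :
    ρ.orbit v (PowerSeries.X ^ k * f) = (ρ.Ap ^ k) (ρ.orbit v f) := by
  induction k with
  | zero => simp
  | succ k ih => rw [pow_succ', mul_assoc, orbit_X_mul, ih, pow_succ', mul_apply_eq_comp]

theorem orbit_mk_mul (v : V) (c : ℕ → ℂ) (f : ℂ⟦X⟧) :
    ρ.orbit v (PowerSeries.mk c * f) = opSeries c ρ.Ap (ρ.orbit v f) := by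
  have h1 : HasSum (fun (k : ℕ) (m : ℕ) => c k * coeff m (PowerSeries.X ^ k * f))
      (fun m => coeff m (PowerSeries.mk c * f) : FockSpace) := by
    refine Pi.hasSum.2 fun m => ?_
    rw [← compSeries_X]
    exact hasSum_coeff_compSeries_mul constantCoeff_X c f m
  have h2 := h1.mapL (ρ.orbitMap v)
  refine (h2.congr_fun fun k => ?_).tsum_eq.symm
  rw [← orbit_X_pow_mul, orbit, ← map_smul]
  rfl

/-- Power series describing the action of `A` on `(A⁺) ^ k v`, for a vacuum `v` on which
`sinh (h E) / h` takes the value `a`. -/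
noncomputable def loweringSeries (w a : ℂ) : ℕ → ℂ⟦X⟧
  | 0 => 0
  | k + 1 => PowerSeries.X * loweringSeries w a k + C a * (PowerSeries.mk (expCoeff w) * PowerSeries.X ^ k)

/-- Power series describing the action of `N` on `(A⁺) ^ k v`, for a vacuum `v` of weight `n`. -/
noncomputable def numberSeries (w n : ℂ) : ℕ → ℂ⟦X⟧
  | 0 => C n
  | k + 1 => PowerSeries.X * numberSeries w n k + PowerSeries.mk (expQuotCoeff w) * PowerSeries.X ^ k

variable {ρ} {v : V} {e n : ℂ}

theorem E_orbit (hE : ρ.E v = e • v) (f : ℂ⟦X⟧) : ρ.E (ρ.orbit v f) = e • ρ.orbit v f := by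
  have : ρ.E.comp (ρ.orbitMap v) = e • ρ.orbitMap v := clm_ext fun k => by
    change ρ.E (ρ.orbitMap v (fockKet k)) = e • ρ.orbitMap v (fockKet k)
    rw [orbitMap_fockKet, E_pow_apply hE]
  exact DFunLike.congr_fun this _

theorem N_pow_apply (hN : ρ.N v = n • v) (k : ℕ) :
    ρ.N ((ρ.Ap ^ k) v) = ρ.orbit v (numberSeries w n k) := by
  induction k with
  | zero =>
    have := ρ.orbit_C_mul v n (PowerSeries.X ^ 0)
    rw [orbit_X_pow] at this
    simpa [numberSeries, hN] using this.symm
  | succ k ih =>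
    rw [numberSeries, orbit_add, orbit_X_mul, orbit_mk_mul, orbit_X_pow, ← ih, ← ρ.comm_N_Ap,
      pow_succ', mul_apply_eq_comp]
    abel

theorem A_pow_apply (hA : ρ.A v = 0) (hE : ρ.E v = e • v) (k : ℕ) :
    ρ.A ((ρ.Ap ^ k) v) = ρ.orbit v (loweringSeries w (sinhQuot h e) k) := by
  induction k with
  | zero => simp [loweringSeries, hA, orbit_zero]
  | succ k ih =>
    rw [loweringSeries, orbit_add, orbit_X_mul, orbit_C_mul,
      ← opSeries_sinhQuotCoeff (E_orbit hE _) h, orbit_mk_mul, orbit_X_pow, ← ih, ← ρ.comm_A_Ap,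
      pow_succ', mul_apply_eq_comp]
    abel

theorem isStable_range_orbitMap (hA : ρ.A v = 0) (hN : ρ.N v = n • v) (hE : ρ.E v = e • v)
    (hc : IsClosed ((ρ.orbitMap v).range : Set V)) : ρ.IsStable (ρ.orbitMap v).range := by
  have key : ∀ T : V →L[ℂ] V, (∀ k, T ((ρ.Ap ^ k) v) ∈ (ρ.orbitMap v).range) →
      ∀ u ∈ (ρ.orbitMap v).range, T u ∈ (ρ.orbitMap v).range := by
    rintro T hT _ ⟨c, rfl⟩
    refine clm_apply_mem (T.comp (ρ.orbitMap v)) _ hc (fun r => ?_) c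
    simpa [orbitMap_fockKet] using hT r
  refine fun u hu => ⟨key _ (fun k => ?_) u hu, key _ (fun k => ?_) u hu,
    key _ (fun k => ?_) u hu, key _ (fun k => ?_) u hu⟩
  · rw [N_pow_apply hN]; exact ⟨_, rfl⟩
  · rw [E_pow_apply hE, ← map_smul]
    exact ⟨e • fockKet k, by simp [orbitMap_fockKet]⟩
  · exact ⟨fockKet (k + 1), by simp [orbitMap_fockKet, pow_succ']⟩
  · rw [A_pow_apply hA hE]; exact ⟨_, rfl⟩

theorem range_orbitMap_eq_top (hirr : ρ.IsIrreducible) (hv : v ≠ 0) (hA : ρ.A v = 0)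
    (hN : ρ.N v = n • v) (hE : ρ.E v = e • v)
    (hc : IsClosed ((ρ.orbitMap v).range : Set V)) : (ρ.orbitMap v).range = ⊤ := by
  refine (hirr.2 _ hc (isStable_range_orbitMap hA hN hE hc)).resolve_left fun hbot => hv ?_
  have : v ∈ (ρ.orbitMap v).range := ⟨fockKet 0, by simp [orbitMap_fockKet]⟩
  rwa [hbot, Submodule.mem_bot] at this

theorem pow_apply_ne_zero (hirr : ρ.IsIrreducible) (hfin : ¬ FiniteDimensional ℂ V) (hv : v ≠ 0)
    (hA : ρ.A v = 0) (hN : ρ.N v = n • v) (hE : ρ.E v = e • v) (m : ℕ) : (ρ.Ap ^ m) v ≠ 0 := by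
  intro hm
  have hle : (ρ.orbitMap v).range ≤
      Submodule.span ℂ (Set.range fun k : Fin m => (ρ.Ap ^ (k : ℕ)) v) := by
    rintro _ ⟨c, rfl⟩
    have h1 := hasSum_sum_of_ne_finset_zero (L := .unconditional ℕ)
      (f := fun k => c k • (ρ.Ap ^ k) v) (s := Finset.range m) fun k hk => by
        have hk : m ≤ k := by simpa using hk
        rw [← Nat.sub_add_cancel hk, pow_add, mul_apply_eq_comp, hm, map_zero, smul_zero]
    have h2 : ρ.orbitMap v c = _ := (ρ.hasSum_orbitMap v c).unique h1
    change ρ.orbitMap v c ∈ _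
    rw [h2]
    refine Submodule.sum_mem _ fun k hk => Submodule.smul_mem _ _ (Submodule.subset_span ?_)
    exact ⟨⟨k, by simpa using hk⟩, rfl⟩
  have hfd : FiniteDimensional ℂ (Submodule.span ℂ (Set.range fun k : Fin m => (ρ.Ap ^ (k : ℕ)) v)) :=
    FiniteDimensional.span_of_finite ℂ (Set.finite_range _)
  have hfd' : FiniteDimensional ℂ (ρ.orbitMap v).range := Submodule.finiteDimensional_of_le hle
  have htop := range_orbitMap_eq_top hirr hv hA hN hE (Submodule.closed_of_finiteDimensional _)
  rw [htop] at hfd'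
  exact hfin (Submodule.topEquiv (R := ℂ) (M := V)).finiteDimensional

theorem orbitMap_injective (hirr : ρ.IsIrreducible) (hfin : ¬ FiniteDimensional ℂ V) (hv : v ≠ 0)
    (hA : ρ.A v = 0) (hN : ρ.N v = n • v) (hE : ρ.E v = e • v) :
    Function.Injective (ρ.orbitMap v) := by
  refine (injective_iff_map_eq_zero _).2 fun c hc => ?_
  by_contra hne
  have hf : (PowerSeries.mk c : ℂ⟦X⟧) ≠ 0 := fun h0 => hne (funext fun k => by
    simpa using congrArg (coeff k) h0)
  have hf0 : ρ.orbit v (PowerSeries.mk c) = 0 := by simpa [orbit] using hc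
  obtain ⟨g, hg⟩ : ∃ g : ℂ⟦X⟧, g * PowerSeries.mk c = PowerSeries.X ^ (PowerSeries.mk c : ℂ⟦X⟧).order.toNat := by
    refine ⟨Inv_divided_by_X_pow_order hf, ?_⟩
    nth_rewrite 2 [← X_pow_order_mul_divXPowOrder (f := (PowerSeries.mk c : ℂ⟦X⟧))]
    rw [mul_left_comm, Inv_divided_by_X_pow_order_leftInv hf, mul_one]
  refine pow_apply_ne_zero hirr hfin hv hA hN hE (PowerSeries.mk c : ℂ⟦X⟧).order.toNat ?_
  rw [← orbit_X_pow, ← hg]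
  have : g = PowerSeries.mk fun k => coeff k g := by ext k; simp
  rw [this, orbit_mk_mul, hf0]
  simp [opSeries]

/-- In an infinite-dimensional irreducible representation with vacuum `v`, the map
`f ↦ f(A⁺) v` is a homeomorphism. -/
theorem exists_orbitEquiv (hirr : ρ.IsIrreducible) (hfin : ¬ FiniteDimensional ℂ V) (hv : v ≠ 0)
    (hA : ρ.A v = 0) (hN : ρ.N v = n • v) (hE : ρ.E v = e • v) :
    ∃ Φ : FockSpace ≃L[ℂ] V, ∀ c, Φ c = ρ.orbitMap v c := by
  obtain ⟨g, hg⟩ := FockSpace.exists_leftInverse (ρ.orbitMap v)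
    (orbitMap_injective hirr hfin hv hA hN hE)
  have hc : IsClosed ((ρ.orbitMap v).range : Set V) := by
    have : ((ρ.orbitMap v).range : Set V) = {x | ρ.orbitMap v (g x) = x} := by
      ext x
      constructor
      · rintro ⟨c, rfl⟩
        exact congrArg (ρ.orbitMap v) (hg c)
      · intro hx
        exact ⟨g x, hx⟩
    rw [this]
    exact isClosed_eq (by fun_prop) continuous_id
  have htop := range_orbitMap_eq_top hirr hv hA hN hE hc
  refine ⟨ContinuousLinearEquiv.equivOfInverse (ρ.orbitMap v) g hg fun x => ?_, fun c => rfl⟩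
  obtain ⟨c, rfl⟩ : x ∈ (ρ.orbitMap v).range := htop ▸ Submodule.mem_top
  exact congrArg (ρ.orbitMap v) (hg c)

theorem sinhQuot_ne_zero (hirr : ρ.IsIrreducible) (hfin : ¬ FiniteDimensional ℂ V) (hv : v ≠ 0)
    (hA : ρ.A v = 0) (hN : ρ.N v = n • v) (hE : ρ.E v = e • v) : sinhQuot h e ≠ 0 := by
  intro h0
  obtain ⟨Φ, hΦ⟩ := exists_orbitEquiv hirr hfin hv hA hN hE
  have hket : ∀ k, Φ (fockKet k) = (ρ.Ap ^ k) v := fun k => by rw [hΦ, orbitMap_fockKet]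
  let l : V →L[ℂ] ℂ := (ContinuousLinearMap.proj (φ := fun _ : ℕ => ℂ) 0).comp
    (Φ.symm : V →L[ℂ] FockSpace)
  have hl : ∀ c, l (Φ c) = c 0 := fun c => by simp [l]
  have hls : ∀ f, l (ρ.orbit v f) = constantCoeff f := fun f => by
    rw [orbit, ← hΦ, hl, coeff_zero_eq_constantCoeff_apply]
  have hlow : ∀ k, loweringSeries w 0 k = 0 := fun k => by
    induction k with
    | zero => rfl
    | succ k ih => simp [loweringSeries, ih]
  have hA0 : ρ.A.comp (Φ : FockSpace →L[ℂ] V) = 0 := clm_ext fun k => by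
    change ρ.A (Φ (fockKet k)) = 0
    rw [hket, A_pow_apply hA hE, h0, hlow, orbit_zero]
  have hlAp : l.comp (ρ.Ap.comp (Φ : FockSpace →L[ℂ] V)) = 0 := clm_ext fun k => by
    have : ρ.Ap ((ρ.Ap ^ k) v) = ρ.orbit v (PowerSeries.X ^ (k + 1)) := by
      rw [orbit_X_pow, pow_succ', mul_apply_eq_comp]
    change l (ρ.Ap (Φ (fockKet k))) = 0
    rw [hket, this, hls]
    simp
  have hlN : l.comp (ρ.N.comp (Φ : FockSpace →L[ℂ] V)) =
      n • l.comp (Φ : FockSpace →L[ℂ] V) := clm_ext fun k => by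
    simp only [ContinuousLinearMap.comp_apply, ContinuousLinearEquiv.coe_coe, hket,
      smul_apply]
    rw [N_pow_apply hN, hls, ← orbit_X_pow, hls]
    rcases k with _ | k
    · simp [numberSeries]
    · simp [numberSeries, expQuotCoeff]
  have hlE : ∀ u, ρ.E u = e • u := fun u => by
    obtain ⟨c, rfl⟩ := Φ.surjective u
    have := E_orbit hE (PowerSeries.mk c)
    simpa [orbit, ← hΦ] using this
  have hstab : ρ.IsStable l.ker := by
    intro u hu
    have hu : l u = 0 := hu
    obtain ⟨c, rfl⟩ := Φ.surjective u
    refine ⟨?_, ?_, ?_, ?_⟩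
    · have := DFunLike.congr_fun hlN c
      simpa [hu] using this
    · change l _ = 0
      rw [hlE, map_smul, hu, smul_zero]
    · simpa using DFunLike.congr_fun hlAp c
    · have : ρ.A (Φ c) = 0 := DFunLike.congr_fun hA0 c
      rw [this]; exact Submodule.zero_mem _
  rcases hirr.2 l.ker l.isClosed_ker hstab with hbot | htop
  · have h1 : Φ (fockKet 1) ∈ l.ker := by
      change l _ = 0
      rw [hl, fockKet_apply]; simp
    rw [hbot, Submodule.mem_bot] at h1
    exact fockKet_ne_zero 1 (by simpa using h1)
  · have h1 : Φ (fockKet 0) ∈ l.ker := htop ▸ Submodule.mem_top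
    have h2 : l (Φ (fockKet 0)) = 0 := h1
    rw [hl, fockKet_apply] at h2
    simp at h2

/-- Two infinite-dimensional irreducible representations with vacua of the same weights are
equivalent. -/
theorem equivalent_of_weights {V' : Type*} [AddCommGroup V'] [Module ℂ V'] [TopologicalSpace V']
    [IsTopologicalAddGroup V'] [ContinuousSMul ℂ V'] [T2Space V'] [PolynormableSpace ℂ V']
    {ρ' : TwistedHeisenbergRep h w V'} {v' : V'}
    (hirr : ρ.IsIrreducible) (hfin : ¬ FiniteDimensional ℂ V) (hv : v ≠ 0)
    (hA : ρ.A v = 0) (hN : ρ.N v = n • v) (hE : ρ.E v = e • v)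
    (hirr' : ρ'.IsIrreducible) (hfin' : ¬ FiniteDimensional ℂ V') (hv' : v' ≠ 0)
    (hA' : ρ'.A v' = 0) (hN' : ρ'.N v' = n • v') (hE' : ρ'.E v' = e • v') :
    ρ.Equivalent ρ' := by
  obtain ⟨Φ, hΦ⟩ := exists_orbitEquiv hirr hfin hv hA hN hE
  obtain ⟨Φ', hΦ'⟩ := exists_orbitEquiv hirr' hfin' hv' hA' hN' hE'
  have horb : ∀ f, Φ' (Φ.symm (ρ.orbit v f)) = ρ'.orbit v' f := fun f => by
    rw [orbit, orbit, ← hΦ, ← hΦ', Φ.symm_apply_apply]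
  have key : ∀ (T : V →L[ℂ] V) (T' : V' →L[ℂ] V') (a : ℕ → ℂ⟦X⟧),
      (∀ k, T ((ρ.Ap ^ k) v) = ρ.orbit v (a k)) → (∀ k, T' ((ρ'.Ap ^ k) v') = ρ'.orbit v' (a k)) →
      ∀ u, Φ' (Φ.symm (T u)) = T' (Φ' (Φ.symm u)) := by
    intro T T' a hT hT' u
    obtain ⟨c, rfl⟩ := Φ.surjective u
    have : ((Φ' : FockSpace →L[ℂ] V').comp (Φ.symm : V →L[ℂ] FockSpace)).comp
        (T.comp (Φ : FockSpace →L[ℂ] V)) = T'.comp (Φ' : FockSpace →L[ℂ] V') :=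
      clm_ext fun k => by
        simp only [ContinuousLinearMap.comp_apply, ContinuousLinearEquiv.coe_coe]
        rw [hΦ, orbitMap_fockKet, hT, horb, hΦ', orbitMap_fockKet, hT']
    rw [Φ.symm_apply_apply]
    exact DFunLike.congr_fun this c
  refine ⟨Φ.symm.trans Φ', fun u => ⟨?_, ?_, ?_, ?_⟩⟩
  · exact key _ _ _ (N_pow_apply hN) (N_pow_apply hN') u
  · refine key _ _ (fun k => C e * PowerSeries.X ^ k) (fun k => ?_) (fun k => ?_) u
    · rw [orbit_C_mul, orbit_X_pow, E_pow_apply hE]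
    · rw [orbit_C_mul, orbit_X_pow, E_pow_apply hE']
  · refine key _ _ (fun k => PowerSeries.X ^ (k + 1)) (fun k => ?_) (fun k => ?_) u
    · rw [orbit_X_pow, pow_succ', mul_apply_eq_comp]
    · rw [orbit_X_pow, pow_succ', mul_apply_eq_comp]
  · exact key _ _ _ (A_pow_apply hA hE) (A_pow_apply hA' hE') u

end Orbit

end TwistedHeisenbergRep

theorem proposition5 (h w : ℂ) (root : ℂ → ℂ) (hroot : ∀ z : ℂ, root z ^ 2 = z) :
    -- the vectors `|r⟩` are a basis of the space of formal series ...
    (∀ c : ℕ → ℂ, HasSum (fun r : ℕ => c r • fockKet r) (c : FockSpace)) ∧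
    -- ... and an orthonormal basis of its subspace of square-summable series
    (∃ b : HilbertBasis ℕ ℂ (lp (fun _ : ℕ => ℂ) 2),
      ∀ r : ℕ, ((b r : lp (fun _ : ℕ => ℂ) 2) : ℕ → ℂ) = fockKet r) ∧
    ∃ π : (e n : ℂ) → sinhQuot h e ≠ 0 → TwistedHeisenbergRep h w FockSpace,
      -- `π e n` is the one and only representation given by the explicit formulas
      (∀ (e n : ℂ) (he : sinhQuot h e ≠ 0) (ρ : TwistedHeisenbergRep h w FockSpace),
        ρ.ActsBy fockKet (root (sinhQuot h e)) e n ↔ ρ = π e n he) ∧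
      -- it is irreducible, infinite dimensional and has a lowest weight vector
      (∀ (e n : ℂ) (he : sinhQuot h e ≠ 0),
        (π e n he).IsIrreducible ∧ ¬ FiniteDimensional ℂ FockSpace ∧
          (π e n he).HasLowestWeightVector) ∧
      -- different labels give inequivalent representations
      (∀ (e n e' n' : ℂ) (he : sinhQuot h e ≠ 0) (he' : sinhQuot h e' ≠ 0),
        (π e n he).Equivalent (π e' n' he') → e = e' ∧ n = n') ∧
      -- every infinite-dimensional irreducible lowest weight representation is some `π e n`
      (∀ (V : Type*) [AddCommGroup V] [Module ℂ V] [TopologicalSpace V]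
        [IsTopologicalAddGroup V] [ContinuousSMul ℂ V] [T2Space V] [PolynormableSpace ℂ V]
        (ρ : TwistedHeisenbergRep h w V),
        ρ.IsIrreducible → ¬ FiniteDimensional ℂ V → ρ.HasLowestWeightVector →
          ∃ (e n : ℂ) (he : sinhQuot h e ≠ 0), ρ.Equivalent (π e n he)) := by
  have hs : ∀ e : ℂ, sinhQuot h e ≠ 0 → root (sinhQuot h e) ≠ 0 := fun e he h0 => he <| by
    rw [← hroot (sinhQuot h e), h0]; simp
  refine ⟨hasSum_smul_fockKet, exists_hilbertBasis_fockKet,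
    fun e n he => fockRep h w n (hs e he) (hroot _), fun e n he ρ => ?_, fun e n he => ?_,
    fun e n e' n' he he' => ?_, fun V _ _ _ _ _ _ _ ρ hirr hfin hlow => ?_⟩
  · refine ⟨fun hρ => hρ.eq (TwistedHeisenbergRep.fockRep_actsBy n _ _), ?_⟩
    rintro rfl
    exact TwistedHeisenbergRep.fockRep_actsBy n _ _
  · exact ⟨TwistedHeisenbergRep.fockRep_isIrreducible n _ _, FockSpace.not_finiteDimensional,
      TwistedHeisenbergRep.fockRep_hasLowestWeightVector n _ _⟩
  · exact TwistedHeisenbergRep.eq_of_equivalent_fockRep _ _ _ _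
  · obtain ⟨v, hv, hA, ⟨n, hN⟩, e, hE⟩ := hlow
    have he := TwistedHeisenbergRep.sinhQuot_ne_zero hirr hfin hv hA hN hE
    obtain ⟨hA', hN', hE'⟩ := TwistedHeisenbergRep.fockRep_fockKet_zero (w := w) n (hs e he)
      (hroot _)
    exact ⟨e, n, he, TwistedHeisenbergRep.equivalent_of_weights hirr hfin hv hA hN hE
      (TwistedHeisenbergRep.fockRep_isIrreducible n _ _) FockSpace.not_finiteDimensional
      (TwistedHeisenbergRep.fockKet_ne_zero 0) hA' hN' hE'⟩
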